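/- Let $n\ge 2$ be an integer, let $\mathcal F_n$ be the free monoid (unital free semigroup) on $n$ generators with word length $|w|$, and let $\mathcal H_n=\ell^2(\mathcal F_n)$ be the complex Fock space with orthonormal basis $\{\xi_w : w\in\mathcal F_n\}$. Let $L_1,\dots,L_n$ be the isometries of $\mathcal H_n$ with $L_i\xi_w=\xi_{iw}$, and let $Q_l$ be the orthogonal projection of $\mathcal H_n$ onto $\operatorname{span}\{\xi_w : |w|<l\}$. For an $n$-tuple $A=(A_1,\dots,A_n)$ of bounded operators on a Hilbert space put $\Phi_A(X)=\sum_{i=1}^n A_iXA_i^*$. The tuple $A$ is a contraction if $\Phi_A(I)\le I$, and a pure contraction if moreover $\Phi_A^k(I)\to 0$ strongly as $k\to\infty$. The pure rank of a contraction $A$ is $\operatorname{rk}(I-\sum_{i=1}^n S_iS_i^*)$, where $S=(S_1,\dots,S_n)$ is the minimal isometric dilation of $A$ to isometries with pairwise orthogonal ranges. The Euler characteristic of a contraction $A$ is $$\chi(A)=(n-1)\lim_{k\to\infty}\frac{\operatorname{rk}(I-\Phi_A^k(I))}{n^k}.$$ Let $\mathcal H\subseteq\mathcal H_n$ be a closed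 subspace that is co-invariant for $L$, i.e. $L_i^*\mathcal H\subseteq\mathcal H$ for all $i$, and let $A=(A_1,\dots,A_n)$ be the $n$-tuple of compressions $A_i=P_{\mathcal H}L_i|_{\mathcal H}$. Suppose that $A$ is a pure contraction with pure rank $1$, and that $Q_l\mathcal H\subseteq\mathcal H$ for all sufficiently large $l$. If $k\ge 0$ is an integer with $$\chi(A)>1-\frac1{n^k},$$ then $\mathcal H$ contains $\operatorname{span}\{\xi_w : |w|\le k\}$. -/

import Mathlib

open Filter Topology ContinuousLinearMap
open scoped ENNReal InnerProduct

noncomputable section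

namespace RowContraction

universe u

section General

variable {E : Type u} [NormedAddCommGroup E] [InnerProductSpace ℂ E] [CompleteSpace E] {n : ℕ}

/-- The completely positive map `Φ_A(X) = ∑ i, A i X (A i)*` of an `n`-tuple `A`. -/
def Phi (A : Fin n → E →L[ℂ] E) (X : E →L[ℂ] E) : E →L[ℂ] E :=
  ∑ i, A i ∘L X ∘L (A i)†

/-- The defect operator `I - Φ_A^k(I)`. -/
def defect (A : Fin n → E →L[ℂ] E) (k : ℕ) : E →L[ℂ] E :=
  1 - (Phi A)^[k] 1

/-- `A` is a (row) contraction: `∑ i, A i (A i)* ≤ I` in the order of self-adjoint operators. -/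
def IsContraction (A : Fin n → E →L[ℂ] E) : Prop :=
  Phi A 1 ≤ 1

/-- `A` is a pure contraction: a row contraction with `Φ_A^k(I) → 0` in the strong operator
topology. -/
def IsPure (A : Fin n → E →L[ℂ] E) : Prop :=
  IsContraction A ∧ ∀ x : E, Tendsto (fun k : ℕ => (Phi A)^[k] 1 x) atTop (𝓝 0)

/-- The rank of an operator, as a natural number or infinity. -/
def rk (T : E →L[ℂ] E) : ℕ∞ :=
  Cardinal.toENat (LinearMap.rank (T : E →ₗ[ℂ] E))

/-- The Euler characteristic `χ(A) = (n - 1) lim_k rk (I - Φ_A^k(I)) / n^k`, in `[0, ∞]`. -/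
def eulerChar (A : Fin n → E →L[ℂ] E) : ℝ≥0∞ :=
  limUnder atTop fun k : ℕ => ((n : ℝ≥0∞) - 1) * ((rk (defect A k) : ℝ≥0∞) / (n : ℝ≥0∞) ^ k)

/-- The operator `A_w = A_{i_1} ⋯ A_{i_d}` for a word `w = i_1 ⋯ i_d`. -/
def wordOp (A : Fin n → E →L[ℂ] E) (w : FreeMonoid (Fin n)) : E →L[ℂ] E :=
  FreeMonoid.lift A w

/-- `S` on `K`, with `E` embedded in `K` by the isometry `V`, is a minimal isometric dilation
of `A`: the `S i` are isometries with pairwise orthogonal ranges, `A i` is the compression of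
`S i` to `E`, the subspace `E` is co-invariant for `S`, and the subspaces `S_w E` span a dense
subspace of `K`. -/
structure IsMinimalIsometricDilation {K : Type u} [NormedAddCommGroup K] [InnerProductSpace ℂ K]
    [CompleteSpace K] (A : Fin n → E →L[ℂ] E) (S : Fin n → K →L[ℂ] K) (V : E →ₗᵢ[ℂ] K) :
    Prop where
  isometries : ∀ i j, (S i)† ∘L S j = if i = j then 1 else 0
  compression : ∀ i, A i = (V.toContinuousLinearMap)† ∘L S i ∘L V.toContinuousLinearMap
  coinvariant : ∀ i x, ((S i)†) (V x) ∈ Set.range V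
  minimal : (Submodule.span ℂ {y | ∃ w x, y = wordOp S w (V x)}).topologicalClosure = ⊤

/-- `A` has pure rank `r`: the rank of `I - ∑ i, S i (S i)*` is `r` for the minimal isometric
dilation `S` of `A` (which is unique up to a unitary that fixes `E`). -/
def HasPureRank (A : Fin n → E →L[ℂ] E) (r : ℕ∞) : Prop :=
  ∃ (K : Type u) (_ : NormedAddCommGroup K) (_ : InnerProductSpace ℂ K) (_ : CompleteSpace K)
    (S : Fin n → K →L[ℂ] K) (V : E →ₗᵢ[ℂ] K),
    IsMinimalIsometricDilation A S V ∧ rk (1 - ∑ i, S i ∘L (S i)†) = r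

end General

/-- The full Fock space `ℓ²(F_n)` over the free monoid `F_n` on `n` generators. -/
abbrev Fock (n : ℕ) : Type :=
  lp (fun _ : FreeMonoid (Fin n) => ℂ) 2

open Classical in
/-- The standard orthonormal basis vector `ξ_w`. -/
def xi {n : ℕ} (w : FreeMonoid (Fin n)) : Fock n :=
  lp.single 2 w (1 : ℂ)

theorem orthonormal_xi (n : ℕ) : Orthonormal ℂ (xi : FreeMonoid (Fin n) → Fock n) := by
  classical
  have h := (HilbertBasis.ofRepr (LinearIsometryEquiv.refl ℂ (Fock n))).orthonormal
  convert h using 1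
  funext w
  rw [← HilbertBasis.repr_symm_single]
  simp only [xi]
  rfl

theorem orthonormal_xi_mul {n : ℕ} (i : Fin n) :
    Orthonormal ℂ fun w : FreeMonoid (Fin n) => xi (FreeMonoid.of i * w) :=
  (orthonormal_xi n).comp _ fun _ _ h => mul_left_cancel h

/-- The left creation operator `L_i`, the isometry with `L_i ξ_w = ξ_{iw}`. -/
def creation {n : ℕ} (i : Fin n) : Fock n →L[ℂ] Fock n :=
  (orthonormal_xi_mul i).orthogonalFamily.linearIsometry.toContinuousLinearMap

theorem creation_xi {n : ℕ} (i : Fin n) (w : FreeMonoid (Fin n)) :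
    creation i (xi w) = xi (FreeMonoid.of i * w) := by
  simp [creation, xi, OrthogonalFamily.linearIsometry_apply_single]

/-- The span of the vectors `ξ_w` with `|w| < l`. -/
def shortSpan (n l : ℕ) : Submodule ℂ (Fock n) :=
  Submodule.span ℂ (xi '' {w | w.length < l})

instance (n l : ℕ) : FiniteDimensional ℂ (shortSpan n l) :=
  FiniteDimensional.span_of_finite ℂ ((List.finite_length_lt (Fin n) l).image xi)

/-- The orthogonal projection `Q_l` of `ℓ²(F_n)` onto the span of the `ξ_w` with `|w| < l`. -/
def Q (n l : ℕ) : Fock n →L[ℂ] Fock n :=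
  (shortSpan n l).starProjection

/-- The `n`-tuple of compressions `A_i = P_H L_i |_H` of the creation operators to a subspace. -/
def compression {n : ℕ} (H : Submodule ℂ (Fock n)) [H.HasOrthogonalProjection] (i : Fin n) :
    H →L[ℂ] H :=
  H.orthogonalProjectionOnto ∘L creation i ∘L H.subtypeL

end RowContraction

end

namespace RowContraction

variable {n : ℕ}

/-! Argue by contraposition: a missing `ξ_{w₀}` forces `χ(A) ≤ 1 - 1/n^{|w₀|}`. By co-invariance `I
- Φ_A^l(I)` is the compression of `Q_l` to `H`; once `Q_l H ⊆ H`, its rank is `d_l = dim (H ∩ span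
{ξ_w : |w| < l})` (`rk_defect`), so `χ(A) = lim (n-1) d_l / n^l`.

If `ξ_{w₀} ∉ H`, some `y ∈ Hᗮ` has a nonzero coefficient at `w₀`. `Hᗮ` is invariant under the `L_i`
and, for large `l`, under `Q_l`. Hence for long words `v` the component of `L_v y` of degree `|v| +
|w₀|` lies in `Hᗮ`. These components are linearly independent
(`linearIndependent_wordOp_homogeneousPart`), and counting them bounds `d_l`
(`sub_one_mul_shortDim_le`): asymptotically `Hᗮ` takes at least the fraction `1/n^{|w₀|}` of the
dimension. -/

/-! ### Coordinates of the creation operators and of `Q_l` -/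

theorem inner_xi (w : FreeMonoid (Fin n)) (x : Fock n) : inner ℂ (xi w) x = x w := by
  classical
  have h := lp.inner_single_left (𝕜 := ℂ) w (1 : ℂ) x
  simp only [xi]
  convert h using 1
  simp

theorem Fock.ext_iff_apply {x y : Fock n} : x = y ↔ ∀ w, x w = y w :=
  ⟨fun h _ => h ▸ rfl, fun h => lp.ext (funext h)⟩

theorem adjoint_creation_apply (i : Fin n) (x : Fock n) (w : FreeMonoid (Fin n)) :
    (((creation i)†) x) w = x (FreeMonoid.of i * w) := by
  rw [← inner_xi, adjoint_inner_right, creation_xi, inner_xi]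

theorem adjoint_creation_xi_one (i : Fin n) : ((creation i)†) (xi 1) = 0 := by
  classical
  rw [Fock.ext_iff_apply]
  intro w
  rw [adjoint_creation_apply, ← inner_xi, orthonormal_iff_ite.1 (orthonormal_xi n), if_neg]
  · rfl
  · intro h
    simpa using congrArg FreeMonoid.length h

theorem adjoint_creation_xi_of_mul (i j : Fin n) (w : FreeMonoid (Fin n)) :
    ((creation i)†) (xi (FreeMonoid.of j * w)) = if i = j then xi w else 0 := by
  classical
  rw [Fock.ext_iff_apply]
  intro v
  rw [adjoint_creation_apply, ← inner_xi, orthonormal_iff_ite.1 (orthonormal_xi n)]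
  have key : FreeMonoid.of i * v = FreeMonoid.of j * w ↔ i = j ∧ v = w := by
    refine ⟨fun h => ?_, fun h => by rw [h.1, h.2]⟩
    have h' := congrArg FreeMonoid.toList h
    simp only [FreeMonoid.toList_of_mul, List.cons.injEq] at h'
    exact ⟨h'.1, FreeMonoid.toList.injective h'.2⟩
  by_cases hij : i = j
  · rw [if_pos hij, ← inner_xi, orthonormal_iff_ite.1 (orthonormal_xi n)]
    simp [hij]
  · rw [if_neg hij, if_neg fun h => hij (key.1 h).1]
    rfl

theorem creation_apply_one (i : Fin n) (x : Fock n) : creation i x 1 = 0 := by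
  rw [← inner_xi, ← adjoint_inner_left, adjoint_creation_xi_one, inner_zero_left]

theorem creation_apply_of_mul (i j : Fin n) (x : Fock n) (w : FreeMonoid (Fin n)) :
    creation i x (FreeMonoid.of j * w) = if i = j then x w else 0 := by
  rw [← inner_xi, ← adjoint_inner_left, adjoint_creation_xi_of_mul]
  split_ifs <;> simp [inner_xi]

theorem Q_xi (l : ℕ) (w : FreeMonoid (Fin n)) :
    Q n l (xi w) = if w.length < l then xi w else 0 := by
  classical
  split_ifs with h
  · exact Submodule.starProjection_eq_self_iff.2 (Submodule.subset_span ⟨w, h, rfl⟩)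
  · refine (Submodule.starProjection_apply_eq_zero_iff _).2 ?_
    rw [shortSpan, Submodule.mem_orthogonal]
    intro u hu
    induction hu using Submodule.span_induction with
    | mem u hu =>
      obtain ⟨v, hv, rfl⟩ := hu
      rw [orthonormal_iff_ite.1 (orthonormal_xi n), if_neg]
      rintro rfl
      exact h hv
    | zero => simp
    | add u v _ _ hu hv => rw [inner_add_left, hu, hv, add_zero]
    | smul c u _ hu => rw [inner_smul_left, hu, mul_zero]

theorem inner_Q_left (l : ℕ) (x y : Fock n) : inner ℂ (Q n l x) y = inner ℂ x (Q n l y) :=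
  Submodule.inner_starProjection_left_eq_right _ _ _

theorem Q_apply (l : ℕ) (x : Fock n) (w : FreeMonoid (Fin n)) :
    Q n l x w = if w.length < l then x w else 0 := by
  rw [← inner_xi, ← inner_Q_left, Q_xi]
  split_ifs <;> simp [inner_xi]

theorem mem_shortSpan_iff {l : ℕ} {x : Fock n} :
    x ∈ shortSpan n l ↔ ∀ w, l ≤ w.length → x w = 0 := by
  rw [← Submodule.starProjection_eq_self_iff, Fock.ext_iff_apply]
  change (∀ w, Q n l x w = x w) ↔ _
  refine forall_congr' fun w => ?_
  rw [Q_apply]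
  split_ifs with h
  · simp [h]
  · simp [not_lt.1 h, eq_comm]

/-- This is the step from `l` to `l + 1` in the computation of `Φ_A^l(I)`. -/
theorem sum_creation_one_sub_Q (l : ℕ) (x : Fock n) :
    ∑ i, creation i (((creation i)†) x - Q n l (((creation i)†) x)) = x - Q n (l + 1) x := by
  rw [Fock.ext_iff_apply]
  intro w
  rw [lp.coeFn_sum, Finset.sum_apply]
  cases w using FreeMonoid.inductionOn' with
  | one => simp [creation_apply_one, Q_apply]
  | of_mul j w =>
    simp only [creation_apply_of_mul, lp.coeFn_sub, Pi.sub_apply, adjoint_creation_apply, Q_apply]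
    simp [add_comm 1]

/-! ### Word operators and homogeneous components -/

theorem wordOp_of_mul (i : Fin n) (v : FreeMonoid (Fin n)) (x : Fock n) :
    wordOp creation (FreeMonoid.of i * v) x = creation i (wordOp creation v x) := by
  simp [wordOp]

theorem wordOp_creation_apply_mul (v w : FreeMonoid (Fin n)) (x : Fock n) :
    wordOp creation v x (v * w) = x w := by
  induction v using FreeMonoid.inductionOn' with
  | one => simp [wordOp]
  | of_mul i v ih => rw [wordOp_of_mul, mul_assoc, creation_apply_of_mul, if_pos rfl, ih]

theorem exists_of_wordOp_creation_apply_ne_zero {v u : FreeMonoid (Fin n)} {x : Fock n}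
    (h : wordOp creation v x u ≠ 0) : ∃ w, u = v * w := by
  induction v using FreeMonoid.inductionOn' generalizing u with
  | one => exact ⟨u, (one_mul u).symm⟩
  | of_mul i v ih =>
    rw [wordOp_of_mul] at h
    cases u using FreeMonoid.inductionOn' with
    | one => exact absurd (creation_apply_one i _) h
    | of_mul j u =>
      rw [creation_apply_of_mul] at h
      split_ifs at h with hij
      · obtain ⟨w, rfl⟩ := ih h
        exact ⟨w, by rw [hij, mul_assoc]⟩
      · exact absurd rfl h

/-- The homogeneous component of degree `d`. -/
noncomputable def homogeneousPart (d : ℕ) (x : Fock n) : Fock n := Q n (d + 1) x - Q n d x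

theorem homogeneousPart_apply (d : ℕ) (x : Fock n) (w : FreeMonoid (Fin n)) :
    homogeneousPart d x w = if w.length = d then x w else 0 := by
  simp only [homogeneousPart, lp.coeFn_sub, Pi.sub_apply, Q_apply]
  split_ifs <;> first | omega | simp

theorem wordOp_homogeneousPart (d : ℕ) (v : FreeMonoid (Fin n)) (x : Fock n) :
    wordOp creation v (homogeneousPart d x) =
      homogeneousPart (v.length + d) (wordOp creation v x) := by
  rw [Fock.ext_iff_apply]
  intro u
  by_cases hu : ∃ w, u = v * w
  · obtain ⟨w, rfl⟩ := hu
    simp [homogeneousPart_apply, wordOp_creation_apply_mul]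
  · have h0 : ∀ z, wordOp creation v z u = 0 := fun z =>
      not_not.1 fun h => hu (exists_of_wordOp_creation_apply_ne_zero h)
    simp [homogeneousPart_apply, h0]

/-- The coefficient at `v * w₀` isolates the index `v`: all words in the support of the homogeneous
part have length `|w₀|`, so `v * w₀ = u * t` with `t` among them forces `u = v`. -/
theorem linearIndependent_wordOp_homogeneousPart {y : Fock n} {w₀ : FreeMonoid (Fin n)}
    (hy : y w₀ ≠ 0) :
    LinearIndependent ℂ fun v : FreeMonoid (Fin n) =>
      wordOp creation v (homogeneousPart w₀.length y) := by
  classical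
  rw [linearIndependent_iff']
  intro s g hg v hv
  have h := Fock.ext_iff_apply.1 hg (v * w₀)
  rw [lp.coeFn_sum, Finset.sum_apply, Finset.sum_eq_single v] at h
  · simpa [wordOp_creation_apply_mul, homogeneousPart_apply, hy] using h
  · intro u _ huv
    rw [lp.coeFn_smul, Pi.smul_apply, smul_eq_mul, mul_eq_zero]
    refine Or.inr (not_not.1 fun hne => huv ?_)
    obtain ⟨t, ht⟩ := exists_of_wordOp_creation_apply_ne_zero hne
    rw [ht, wordOp_creation_apply_mul, homogeneousPart_apply] at hne
    have hlen : t.length = w₀.length := not_not.1 fun hc => hne (if_neg hc)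
    have h' := congrArg FreeMonoid.toList ht
    simp only [FreeMonoid.toList_mul] at h'
    exact (FreeMonoid.toList.injective (List.append_inj_left' h' hlen.symm)).symm
  · exact fun hc => absurd hv hc

/-! ### Dimension counts for a co-invariant subspace -/

section Subspace

variable {H : Submodule ℂ (Fock n)}

theorem wordOp_creation_mem_orthogonal
    (hco : ∀ i : Fin n, ∀ x ∈ H, ((creation i)†) x ∈ H) {x : Fock n} (hx : x ∈ Hᗮ)
    (v : FreeMonoid (Fin n)) : wordOp creation v x ∈ Hᗮ := by
  induction v using FreeMonoid.inductionOn' with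
  | one => simpa [wordOp] using hx
  | of_mul i v ih =>
    rw [wordOp_of_mul, Submodule.mem_orthogonal]
    intro u hu
    rw [← adjoint_inner_left]
    exact ih _ (hco i u hu)

theorem Q_mem_orthogonal {l : ℕ} (hQ : ∀ x ∈ H, Q n l x ∈ H) {x : Fock n} (hx : x ∈ Hᗮ) :
    Q n l x ∈ Hᗮ := by
  rw [Submodule.mem_orthogonal]
  intro u hu
  rw [← inner_Q_left]
  exact hx _ (hQ u hu)

/-- `dim (H ∩ span {ξ_w : |w| < l})`. -/
noncomputable def shortDim (H : Submodule ℂ (Fock n)) (l : ℕ) : ℕ :=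
  Module.finrank ℂ ↥(H ⊓ shortSpan n l)

instance (l : ℕ) : FiniteDimensional ℂ ↥(H ⊓ shortSpan n l) :=
  Submodule.finiteDimensional_of_le inf_le_right

/-- A vector is determined by its coefficient at the empty word and by its images under the `L_i*`,
which stay in `H` and lower degree by one. -/
theorem shortDim_succ_le (hco : ∀ i : Fin n, ∀ x ∈ H, ((creation i)†) x ∈ H) (l : ℕ) :
    shortDim H (l + 1) ≤ 1 + n * shortDim H l := by
  have hmem : ∀ i, ∀ x ∈ H ⊓ shortSpan n (l + 1), ((creation i)†) x ∈ H ⊓ shortSpan n l := by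
    intro i x hx
    refine ⟨hco i x hx.1, mem_shortSpan_iff.2 fun w hw => ?_⟩
    rw [adjoint_creation_apply]
    exact mem_shortSpan_iff.1 hx.2 _ (by simp; omega)
  let f : ↥(H ⊓ shortSpan n (l + 1)) →ₗ[ℂ] ℂ × (Fin n → ↥(H ⊓ shortSpan n l)) :=
    LinearMap.prod ((innerSL ℂ (xi 1)).toLinearMap ∘ₗ Submodule.subtype _)
      (LinearMap.pi fun i => ((creation i)†).toLinearMap.restrict (hmem i))
  have hf : Function.Injective f := by
    rw [injective_iff_map_eq_zero]
    intro x hx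
    obtain ⟨h1, h2⟩ := Prod.mk.inj hx
    apply Subtype.ext
    rw [Fock.ext_iff_apply]
    intro w
    cases w using FreeMonoid.inductionOn' with
    | one => exact (inner_xi _ _).symm.trans h1
    | of_mul i w =>
      have h3 : ((creation i)†) (x : Fock n) = 0 := congrArg Subtype.val (congrFun h2 i)
      rw [← adjoint_creation_apply, h3]
      rfl
  have h := LinearMap.finrank_le_finrank_of_injective hf
  simpa [shortDim, Module.finrank_prod, Module.finrank_pi_fintype] using h

theorem sub_one_mul_shortDim_add_one_le (hn : 2 ≤ n) (l : ℕ) :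
    ((n : ℝ) - 1) * shortDim (⊤ : Submodule ℂ (Fock n)) l + 1 ≤ (n : ℝ) ^ l := by
  have hn' : (2 : ℝ) ≤ n := by exact_mod_cast hn
  induction l with
  | zero =>
    have : shortSpan n 0 = ⊥ := by simp [shortSpan]
    rw [shortDim, this, inf_bot_eq]
    simp
  | succ l ih =>
    have h : (shortDim (⊤ : Submodule ℂ (Fock n)) (l + 1) : ℝ)
        ≤ 1 + n * shortDim (⊤ : Submodule ℂ (Fock n)) l := by
      exact_mod_cast shortDim_succ_le (fun _ _ _ => Submodule.mem_top) l
    rw [pow_succ]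
    nlinarith

theorem sub_one_mul_shortDim_le (hn : 2 ≤ n) [CompleteSpace H]
    (hco : ∀ i : Fin n, ∀ x ∈ H, ((creation i)†) x ∈ H) {l₀ : ℕ}
    (hQ : ∀ l, l₀ ≤ l → ∀ x ∈ H, Q n l x ∈ H) {w₀ : FreeMonoid (Fin n)} (hw₀ : xi w₀ ∉ H)
    (j : ℕ) :
    ((n : ℝ) - 1) * shortDim H (j + l₀ + w₀.length) + 1 + (n : ℝ) ^ (j + l₀) ≤
      (n : ℝ) ^ (j + l₀ + w₀.length) + (n : ℝ) ^ l₀ := by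
  have hn' : (2 : ℝ) ≤ n := by exact_mod_cast hn
  -- `H` is complete, so `H = Hᗮᗮ`.
  obtain ⟨y, hy, hyw⟩ : ∃ y ∈ Hᗮ, y w₀ ≠ 0 := by
    by_contra! hc
    refine hw₀ ?_
    rw [← Submodule.orthogonal_orthogonal H, Submodule.mem_orthogonal']
    intro y hy
    rw [inner_xi, hc y hy]
  -- Indexes the words `v` with `l₀ ≤ |v| < l₀ + j`: long enough for the projections `Q` below to
  -- preserve `Hᗮ`, short enough for degree `|v| + |w₀|` to stay below `j + l₀ + |w₀|`.
  let ι := Σ m : Fin j, (Fin (m + l₀) → Fin n)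
  let e : ι → FreeMonoid (Fin n) := fun p => FreeMonoid.ofList (List.ofFn p.2)
  have he : Function.Injective e := by
    rintro ⟨⟨a, ha⟩, f⟩ ⟨⟨b, hb⟩, g⟩ h
    have h' : List.ofFn f = List.ofFn g := FreeMonoid.ofList.injective h
    have hab : a = b := by simpa using congrArg List.length h'
    subst hab
    rw [List.ofFn_injective h']
  have hlen : ∀ p : ι, (e p).length = p.1 + l₀ := fun p => List.length_ofFn
  have hli := (linearIndependent_wordOp_homogeneousPart hyw).comp e he
  set b : ι → Fock n := (fun v => wordOp creation v (homogeneousPart w₀.length y)) ∘ e with hb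
  have hbH : ∀ p, b p ∈ Hᗮ := by
    intro p
    simp only [hb, Function.comp_apply, wordOp_homogeneousPart, hlen]
    have hw := wordOp_creation_mem_orthogonal hco hy (e p)
    exact Submodule.sub_mem _ (Q_mem_orthogonal (hQ _ (by omega)) hw)
      (Q_mem_orthogonal (hQ _ (by omega)) hw)
  have hbS : ∀ p, b p ∈ shortSpan n (j + l₀ + w₀.length) := by
    intro p
    rw [mem_shortSpan_iff]
    intro w hw
    simp only [hb, Function.comp_apply, wordOp_homogeneousPart, hlen]
    rw [homogeneousPart_apply, if_neg]
    have := p.1.2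
    omega
  let G := Submodule.span ℂ (Set.range b)
  have hGfin : FiniteDimensional ℂ G := FiniteDimensional.span_of_finite ℂ (Set.finite_range b)
  have hG : Module.finrank ℂ G = Fintype.card ι := finrank_span_eq_card hli
  have hGH : G ≤ Hᗮ := Submodule.span_le.2 (Set.range_subset_iff.2 hbH)
  have hGS : G ≤ shortSpan n (j + l₀ + w₀.length) :=
    Submodule.span_le.2 (Set.range_subset_iff.2 hbS)
  have hdisj : (H ⊓ shortSpan n (j + l₀ + w₀.length)) ⊓ G = ⊥ :=
    ((Submodule.orthogonal_disjoint H).mono inf_le_left hGH).eq_bot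
  have hsum := Submodule.finrank_sup_add_finrank_inf_eq
    (H ⊓ shortSpan n (j + l₀ + w₀.length)) G
  rw [hdisj, finrank_bot, add_zero, hG] at hsum
  have hle : Module.finrank ℂ ↥((H ⊓ shortSpan n (j + l₀ + w₀.length)) ⊔ G) ≤
      shortDim ⊤ (j + l₀ + w₀.length) :=
    Submodule.finrank_mono (sup_le (inf_le_inf_right _ le_top) (le_inf le_top hGS))
  have hcard : ((n : ℝ) - 1) * Fintype.card ι + (n : ℝ) ^ l₀ = (n : ℝ) ^ (j + l₀) := by
    have h1 : Fintype.card ι = (∑ m ∈ Finset.range j, n ^ m) * n ^ l₀ := by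
      simp [ι, Finset.sum_mul, ← pow_add, Finset.sum_range]
    have h2 := mul_geom_sum (n : ℝ) j
    rw [h1]
    push_cast
    rw [← mul_assoc, h2, pow_add]
    ring
  have htot : (shortDim H (j + l₀ + w₀.length) : ℝ) + Fintype.card ι ≤
      shortDim (⊤ : Submodule ℂ (Fock n)) (j + l₀ + w₀.length) := by
    rw [shortDim]
    exact_mod_cast hsum ▸ hle
  have hN := sub_one_mul_shortDim_add_one_le hn (j + l₀ + w₀.length)
  nlinarith

/-- The `+ 1` turns `d_{l+1} ≤ 1 + n d_l` into monotonicity of the quotient; it disappears in the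
limit. -/
theorem exists_tendsto_shortDim (hn : 2 ≤ n)
    (hco : ∀ i : Fin n, ∀ x ∈ H, ((creation i)†) x ∈ H) :
    ∃ c : ℝ, Tendsto (fun l => (((n : ℝ) - 1) * shortDim H l + 1) / (n : ℝ) ^ l) atTop (𝓝 c) := by
  have hn' : (2 : ℝ) ≤ n := by exact_mod_cast hn
  refine ⟨_, tendsto_atTop_ciInf (antitone_nat_of_succ_le fun l => ?_) ⟨0, ?_⟩⟩
  · have h : (shortDim H (l + 1) : ℝ) ≤ 1 + n * shortDim H l := by
      exact_mod_cast shortDim_succ_le hco l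
    rw [pow_succ, div_le_div_iff₀ (by positivity) (by positivity)]
    have h' : ((n : ℝ) - 1) * shortDim H (l + 1) + 1 ≤
        (((n : ℝ) - 1) * shortDim H l + 1) * n := by nlinarith
    calc _ ≤ (((n : ℝ) - 1) * shortDim H l + 1) * n * (n : ℝ) ^ l := by gcongr
      _ = _ := by ring
  · rintro _ ⟨l, rfl⟩
    have : (0 : ℝ) ≤ n - 1 := by linarith
    positivity

/-! ### Defect operators and the Euler characteristic -/

theorem inner_iterate_Phi [CompleteSpace H]
    (hco : ∀ i : Fin n, ∀ x ∈ H, ((creation i)†) x ∈ H) (l : ℕ) (x y : H) :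
    inner ℂ ((Phi (compression H))^[l] 1 x) y = inner ℂ ((x : Fock n) - Q n l x) (y : Fock n) := by
  -- Co-invariance makes `A_i*` the restriction of `L_i*`, with no projection left.
  have hadj : ∀ (i : Fin n) (x : H), ((((compression H i)†) x : H) : Fock n) = ((creation i)†) x := by
    intro i x
    have : ((compression H i)†) x = ⟨((creation i)†) x, hco i x x.2⟩ := by
      refine ext_inner_right ℂ fun z => ?_
      rw [adjoint_inner_left]
      simp only [compression, Submodule.coe_inner]
      rw [adjoint_inner_left]
      simp only [comp_apply, Submodule.subtypeL_apply, Submodule.coe_orthogonalProjectionOnto_apply]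
      rw [← Submodule.inner_starProjection_left_eq_right,
        Submodule.starProjection_eq_self_iff.2 x.2]
    rw [this]
  induction l generalizing x y with
  | zero =>
    have : Q n 0 (x : Fock n) = 0 := by
      rw [Fock.ext_iff_apply]
      intro w
      simp [Q_apply]
    simp [this]
  | succ l ih =>
    rw [Function.iterate_succ_apply', ← sum_creation_one_sub_Q, sum_inner]
    simp only [Phi, sum_apply, sum_inner, comp_apply]
    refine Finset.sum_congr rfl fun i _ => ?_
    rw [← adjoint_inner_right, ih, hadj, hadj, adjoint_inner_right]

theorem coe_defect_apply [CompleteSpace H]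
    (hco : ∀ i : Fin n, ∀ x ∈ H, ((creation i)†) x ∈ H) {l : ℕ}
    (hQ : ∀ x ∈ H, Q n l x ∈ H) (x : H) :
    (defect (compression H) l x : Fock n) = Q n l x := by
  have : defect (compression H) l x = ⟨Q n l x, hQ x x.2⟩ := by
    refine ext_inner_right ℂ fun y => ?_
    rw [defect, sub_apply, inner_sub_left, inner_iterate_Phi hco, inner_sub_left]
    simp
  rw [this]

theorem rk_defect [CompleteSpace H]
    (hco : ∀ i : Fin n, ∀ x ∈ H, ((creation i)†) x ∈ H) {l : ℕ}
    (hQ : ∀ x ∈ H, Q n l x ∈ H) : rk (defect (compression H) l) = shortDim H l := by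
  have hrange : (LinearMap.range (defect (compression H) l : H →ₗ[ℂ] H)).map H.subtype =
      H ⊓ shortSpan n l := by
    ext z
    constructor
    · rintro ⟨_, ⟨x, rfl⟩, rfl⟩
      exact ⟨Subtype.prop _, (congrArg (· ∈ shortSpan n l) (coe_defect_apply hco hQ x)).mpr
        (Submodule.starProjection_apply_mem _ _)⟩
    · rintro ⟨h1, h2⟩
      refine ⟨_, ⟨⟨z, h1⟩, rfl⟩, (coe_defect_apply hco hQ ⟨z, h1⟩).trans ?_⟩
      exact Submodule.starProjection_eq_self_iff.2 h2
  have h := LinearEquiv.rank_eq (Submodule.equivMapOfInjective H.subtype H.subtype_injective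
    (LinearMap.range (defect (compression H) l : H →ₗ[ℂ] H)))
  rw [rk, LinearMap.rank, h, hrange, ← Module.finrank_eq_rank, Cardinal.toENat_nat, shortDim]

theorem eulerChar_compression [CompleteSpace H] (hn : 2 ≤ n)
    (hco : ∀ i : Fin n, ∀ x ∈ H, ((creation i)†) x ∈ H)
    (hQ : ∀ᶠ l : ℕ in atTop, ∀ x ∈ H, Q n l x ∈ H) {c : ℝ}
    (hc : Tendsto (fun l => (((n : ℝ) - 1) * shortDim H l + 1) / (n : ℝ) ^ l) atTop (𝓝 c)) :
    eulerChar (compression H) = ENNReal.ofReal c := by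
  have hn' : (2 : ℝ) ≤ n := by exact_mod_cast hn
  refine Tendsto.limUnder_eq ?_
  have hc' : Tendsto (fun l => ((n : ℝ) - 1) * (shortDim H l / (n : ℝ) ^ l)) atTop (𝓝 c) := by
    have h0 : Tendsto (fun l : ℕ => ((n : ℝ) ^ l)⁻¹) atTop (𝓝 0) :=
      (tendsto_pow_atTop_atTop_of_one_lt (by linarith)).inv_tendsto_atTop
    have h := hc.sub h0
    rw [sub_zero] at h
    refine h.congr fun l => ?_
    ring
  refine (ENNReal.tendsto_ofReal hc').congr' ?_
  filter_upwards [hQ] with l hl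
  rw [rk_defect hco hl, ENNReal.ofReal_mul (by linarith),
    ENNReal.ofReal_div_of_pos (by positivity), ENNReal.ofReal_pow (by positivity),
    ENNReal.ofReal_sub _ zero_le_one]
  simp

theorem eulerChar_compression_le [CompleteSpace H] (hn : 2 ≤ n)
    (hco : ∀ i : Fin n, ∀ x ∈ H, ((creation i)†) x ∈ H)
    (hQ : ∀ᶠ l : ℕ in atTop, ∀ x ∈ H, Q n l x ∈ H)
    {w₀ : FreeMonoid (Fin n)} (hw₀ : xi w₀ ∉ H) :
    eulerChar (compression H) ≤ 1 - 1 / (n : ℝ≥0∞) ^ w₀.length := by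
  have hn' : (2 : ℝ) ≤ n := by exact_mod_cast hn
  obtain ⟨c, hc⟩ := exists_tendsto_shortDim hn hco
  obtain ⟨l₀, hl₀⟩ := eventually_atTop.1 hQ
  rw [eulerChar_compression hn hco hQ hc]
  have hle : c ≤ 1 - 1 / (n : ℝ) ^ w₀.length := by
    have h0 : Tendsto (fun l : ℕ => 1 - 1 / (n : ℝ) ^ w₀.length + (n : ℝ) ^ l₀ * ((n : ℝ) ^ l)⁻¹)
        atTop (𝓝 (1 - 1 / (n : ℝ) ^ w₀.length + (n : ℝ) ^ l₀ * 0)) :=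
      ((tendsto_pow_atTop_atTop_of_one_lt (by linarith)).inv_tendsto_atTop.const_mul _).const_add _
    rw [mul_zero, add_zero] at h0
    -- The boundary term `n^{l₀}`, from the words shorter than `l₀` left out of the count, is
    -- negligible against `n^l`.
    refine le_of_tendsto_of_tendsto hc h0 ?_
    filter_upwards [eventually_ge_atTop (l₀ + w₀.length)] with l hl
    obtain ⟨j, rfl⟩ : ∃ j, l = j + l₀ + w₀.length := ⟨l - (l₀ + w₀.length), by omega⟩
    have h := sub_one_mul_shortDim_le hn hco hl₀ hw₀ j
    rw [div_le_iff₀ (by positivity)]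
    have hpos : (n : ℝ) ^ (j + l₀ + w₀.length) ≠ 0 := by positivity
    have hsplit : 1 / (n : ℝ) ^ w₀.length * (n : ℝ) ^ (j + l₀ + w₀.length) =
        (n : ℝ) ^ (j + l₀) := by
      rw [pow_add _ (j + l₀)]
      field_simp
    rw [add_mul, sub_mul (1 : ℝ) (1 / (n : ℝ) ^ w₀.length), hsplit, mul_assoc, inv_mul_cancel₀ hpos]
    linarith
  calc ENNReal.ofReal c ≤ ENNReal.ofReal (1 - 1 / (n : ℝ) ^ w₀.length) :=
        ENNReal.ofReal_le_ofReal hle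
    _ = 1 - 1 / (n : ℝ≥0∞) ^ w₀.length := by
      rw [ENNReal.ofReal_sub _ (by positivity), ENNReal.ofReal_div_of_pos (by positivity),
        ENNReal.ofReal_pow (by positivity)]
      simp

end Subspace

end RowContraction

theorem mainTheorem8 (n : ℕ) (hn : 2 ≤ n)
    (H : Submodule ℂ (RowContraction.Fock n)) [CompleteSpace H]
    (hco : ∀ i : Fin n, ∀ x ∈ H, ((RowContraction.creation i)†) x ∈ H)
    (A : Fin n → H →L[ℂ] H) (hA : ∀ i, A i = RowContraction.compression H i)
    (hpure : RowContraction.IsPure A)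
    (hrank : RowContraction.HasPureRank A 1)
    (hQ : ∀ᶠ l : ℕ in atTop, ∀ x ∈ H, RowContraction.Q n l x ∈ H)
    (k : ℕ) (hχ : 1 - 1 / (n : ℝ≥0∞) ^ k < RowContraction.eulerChar A) :
    Submodule.span ℂ (RowContraction.xi '' {w : FreeMonoid (Fin n) | w.length ≤ k}) ≤ H := by

  obtain rfl : A = RowContraction.compression H := funext hA
  refine Submodule.span_le.2 ?_
  rintro _ ⟨w, hw, rfl⟩
  by_contra hwH
  refine absurd (hχ.trans_le (RowContraction.eulerChar_compression_le hn hco hQ hwH)) (not_lt.2 ?_)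
  -- Since `|w| ≤ k`, the bound for `w` is at most `1 - 1/n^k`.
  refine tsub_le_tsub_left ?_ 1
  have h1 : (1 : ℝ≥0∞) ≤ n := by exact_mod_cast (by omega : 1 ≤ n)
  have h2 : w.length ≤ k := hw
  gcongr
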